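/- Let $n\ge 4$, let $\mathbb{Z}_n=\{0,1,\dots,n-1\}$ be the cyclic group with normalized counting measure $\mu_n$, and let $\psi_n(k)=\min(k,n-k)$ and $\chi_k(x)=e^{2\pi i kx/n}$ for $0\le k,x\le n-1$. Let $(P_t)_{t\ge 0}$ be the semigroup $$P_t\Big(\sum_{k=0}^{n-1}a_k\chi_k\Big)=\sum_{k=0}^{n-1}e^{-t\psi_n(k)}a_k\chi_k ,$$ and let $A_{\psi_n}f=\lim_{t\to0^+}\frac{f-P_tf}{t}$ be its generator. Then for every $f:\mathbb{Z}_n\to[0,\infty)$, $$\int_{\mathbb{Z}_n} f^2\log f^2\,d\mu_n-\|f\|_2^2\log\|f\|_2^2\le 2\,\langle f,A_{\psi_n}f\rangle_{L_2(\mathbb{Z}_n,\mu_n)},$$ where $\|f\|_2^2=\int_{\mathbb{Z}_n} f^2\,d\mu_n$ and $0\log 0=0$. The constant $2$ is optimal: for each $n\ge4$, if a real number $C$ satisfies $$\int_{\mathbb{Z}_n} f^2\log f^2\,d\mu_n-\|f\|_2^2\log\|f\|_2^2\le C\,\langle f,A_{\psi_n}f\rangle_{L_2(\mathbb{Z}_n,\mu_n)}$$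 for every $f:\mathbb{Z}_n\to[0,\infty)$, then $C\ge 2$. -/

import Mathlib

open MeasureTheory
open scoped ENNReal

namespace CyclicLSI

/-- The normalized counting measure `μ_n` on `ℤ/nℤ`. -/
noncomputable def mu (n : ℕ) : Measure (ZMod n) := (n : ℝ≥0∞)⁻¹ • Measure.count

/-- The word length `ψ_n(k) = min(k, n - k)`, where `k` is represented in `{0, …, n - 1}`. -/
def psi (n : ℕ) (k : ZMod n) : ℕ := min k.val (n - k.val)

/-- The character `χ_k(x) = exp(2πikx/n)`. -/
noncomputable def chi (n : ℕ) (k x : ZMod n) : ℂ :=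
  Complex.exp (2 * Real.pi * Complex.I * k.val * x.val / n)

/-- The coefficient `a_k` in the expansion `f = ∑ k, a_k χ_k`; see `sum_coeff_mul_chi`. -/
noncomputable def coeff (n : ℕ) [NeZero n] (f : ZMod n → ℂ) (k : ZMod n) : ℂ :=
  (n : ℂ)⁻¹ * ∑ x : ZMod n, (starRingEnd ℂ) (chi n k x) * f x

/-- The Poisson-like semigroup: `P_t f = ∑ k, exp(-t ψ_n(k)) a_k χ_k` for `f = ∑ k, a_k χ_k`. -/
noncomputable def poisson (n : ℕ) [NeZero n] (t : ℝ) (f : ZMod n → ℂ) : ZMod n → ℂ :=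
  fun x => ∑ k : ZMod n, (Real.exp (-t * psi n k) : ℂ) * coeff n f k * chi n k x

/-- The generator `A` of the semigroup, `A f = lim_{t → 0⁺} (f - P_t f) / t`, so `P_t = exp(-t A)`.
The derivative exists for every `f`; see `hasDerivWithinAt_poisson`. -/
noncomputable def generator (n : ℕ) [NeZero n] (f : ZMod n → ℂ) : ZMod n → ℂ :=
  -derivWithin (fun t : ℝ => poisson n t f) (Set.Ici 0) 0

/-- The inner product of `L₂(ℤ/nℤ, μ_n)`. -/
noncomputable def l2Inner (n : ℕ) (f g : ZMod n → ℂ) : ℂ :=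
  ∫ x, (starRingEnd ℂ) (f x) * g x ∂(mu n)

/-- The quadratic form `⟨f, A f⟩` for real-valued `f`. The inner product is a real number; see
`l2Inner_generator`. -/
noncomputable def energy (n : ℕ) [NeZero n] (f : ZMod n → ℝ) : ℝ :=
  (l2Inner n (fun x => (f x : ℂ)) (generator n (fun x => (f x : ℂ)))).re

/-- The entropy `∫ f² log f² dμ_n - ‖f‖₂² log ‖f‖₂²`; `0 log 0 = 0` as `Real.log 0 = 0`. -/
noncomputable def entropy (n : ℕ) (f : ZMod n → ℝ) : ℝ :=
  (∫ x, f x ^ 2 * Real.log (f x ^ 2) ∂(mu n))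
    - lpNorm f 2 (mu n) ^ 2 * Real.log (lpNorm f 2 (mu n) ^ 2)

theorem chi_eq_stdAddChar (n : ℕ) [NeZero n] (k x : ZMod n) :
    chi n k x = ZMod.stdAddChar (k * x) := by
  have h := ZMod.stdAddChar_coe (N := n) ((k.val : ℤ) * (x.val : ℤ))
  have e : (((k.val : ℤ) * (x.val : ℤ) : ℤ) : ZMod n) = k * x := by
    push_cast
    simp
  rw [e] at h
  rw [h, chi]
  push_cast
  congr 1
  ring

theorem conj_chi (n : ℕ) [NeZero n] (k x : ZMod n) :
    (starRingEnd ℂ) (chi n k x) = ZMod.stdAddChar (-(x * k)) := by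
  rw [chi_eq_stdAddChar, AddChar.map_neg_eq_conj, mul_comm]

theorem coeff_eq_dft (n : ℕ) [NeZero n] (f : ZMod n → ℂ) (k : ZMod n) :
    coeff n f k = (n : ℂ)⁻¹ * ZMod.dft f k := by
  simp only [coeff, ZMod.dft_apply, conj_chi, smul_eq_mul]

theorem sum_coeff_mul_chi (n : ℕ) [NeZero n] (f : ZMod n → ℂ) (x : ZMod n) :
    ∑ k : ZMod n, coeff n f k * chi n k x = f x := by
  have h := ZMod.invDFT_apply (ZMod.dft f) x
  rw [LinearEquiv.symm_apply_apply] at h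
  rw [h, smul_eq_mul, Finset.mul_sum]
  refine Finset.sum_congr rfl fun k _ => ?_
  rw [coeff_eq_dft, chi_eq_stdAddChar, smul_eq_mul]
  ring

theorem hasDerivWithinAt_poisson (n : ℕ) [NeZero n] (f : ZMod n → ℂ) :
    HasDerivWithinAt (fun t : ℝ => poisson n t f)
      (fun x => -∑ k : ZMod n, (psi n k : ℂ) * coeff n f k * chi n k x) (Set.Ici 0) 0 := by
  apply HasDerivAt.hasDerivWithinAt
  rw [hasDerivAt_pi]
  intro x
  simp only [poisson]
  rw [← Finset.sum_neg_distrib]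
  refine HasDerivAt.fun_sum fun k _ => ?_
  have h1 : HasDerivAt (fun t : ℝ => Real.exp (-t * psi n k)) (-(psi n k : ℝ)) 0 := by
    have h0 : HasDerivAt (fun t : ℝ => -t * (psi n k : ℝ)) (-1 * (psi n k : ℝ)) 0 :=
      ((hasDerivAt_id (0 : ℝ)).fun_neg).mul_const _
    simpa using h0.exp
  have h2 := (h1.ofReal_comp.mul_const (coeff n f k)).mul_const (chi n k x)
  refine h2.congr_deriv ?_
  push_cast
  ring

theorem generator_apply (n : ℕ) [NeZero n] (f : ZMod n → ℂ) (x : ZMod n) :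
    generator n f x = ∑ k : ZMod n, (psi n k : ℂ) * coeff n f k * chi n k x := by
  rw [generator, (hasDerivWithinAt_poisson n f).derivWithin
    (uniqueDiffOn_Ici (0 : ℝ) 0 Set.self_mem_Ici)]
  simp

theorem integral_mu {E : Type*} [NormedAddCommGroup E] [NormedSpace ℝ E] [CompleteSpace E]
    (n : ℕ) [NeZero n] (g : ZMod n → E) :
    ∫ x, g x ∂(mu n) = (n : ℝ)⁻¹ • ∑ x : ZMod n, g x := by
  rw [mu, integral_smul_measure, integral_fintype .of_finite]
  simp

theorem lpNorm_two_sq (n : ℕ) [NeZero n] (f : ZMod n → ℝ) :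
    lpNorm f 2 (mu n) ^ 2 = (n : ℝ)⁻¹ * ∑ x : ZMod n, f x ^ 2 := by
  have hm : AEStronglyMeasurable f (mu n) :=
    (measurable_of_countable f).aestronglyMeasurable
  rw [lpNorm_eq_integral_norm_rpow_toReal (by norm_num) (by norm_num) hm, integral_mu]
  have h0 : 0 ≤ (n : ℝ)⁻¹ * ∑ x : ZMod n, f x ^ 2 := by positivity
  simp only [ENNReal.toReal_ofNat, Real.rpow_two, Real.norm_eq_abs, sq_abs, smul_eq_mul]
  rw [← Real.rpow_natCast, ← Real.rpow_mul h0]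
  norm_num

theorem l2Inner_generator (n : ℕ) [NeZero n] (f : ZMod n → ℂ) :
    l2Inner n f (generator n f) = ((∑ k : ZMod n, psi n k * ‖coeff n f k‖ ^ 2 : ℝ) : ℂ) := by
  rw [l2Inner, integral_mu, Complex.real_smul]
  simp only [generator_apply, Finset.mul_sum]
  rw [Finset.sum_comm]
  push_cast
  refine Finset.sum_congr rfl fun k _ => ?_
  rw [← Complex.conj_mul']
  have h : (starRingEnd ℂ) (coeff n f k)
      = (n : ℂ)⁻¹ * ∑ x : ZMod n, chi n k x * (starRingEnd ℂ) (f x) := by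
    simp [coeff, map_sum]
  rw [h, Finset.mul_sum, Finset.sum_mul, Finset.mul_sum]
  refine Finset.sum_congr rfl fun x _ => ?_
  ring

end CyclicLSI

/-! Scaling reduces the inequality to ‖f‖₂ = 1. Let m be the mean of f, g = f - m, and E the energy,
which is the same for f and g. On y ≥ 0 the function y² log y² lies below a cubic that agrees with
it to third order at y = 1 (`sq_mul_log_sq_le`), so the entropy is bounded in terms of m and ∫ g³.

In Fourier coefficients, ∫ g³ is a sum over triples of nonzero frequencies adding up to zero. Some
two entries of each triple have the same sign, and AM-GM splits the term into the square of the
third coefficient and the product of the squares of the pair. Distributing each triple over its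
same-sign pairs (`share`) and counting (`sum_share_sq_le`) makes the first part cost at most (ψ(k) -
1)|a_k|², whence ∫ g³ ≤ 3(E - ‖g‖₂²) + (3/4)‖g‖₂⁴ (`sum_cube_le`). Since ‖g‖₂² = 1 - m², this yields
entropy ≤ 2E - (1 - m)³(3m + 1)/6 with 0 ≤ m ≤ 1.

For optimality, 1 + εg with g = χ₁ + χ₋₁ has energy ‖εg‖₂², because ψ(±1) = 1, and entropy 2‖εg‖₂²
to leading order as ε → 0. -/

namespace CyclicLSI

/-! ### Polynomial bounds for the logarithm. -/

section LogBounds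

/-- The difference of the two sides has derivative (2/3)(y - 1)³/y³, so its minimum is at y = 1,
where it vanishes. -/
theorem two_mul_log_le {y : ℝ} (hy : 0 < y) :
    2 * Real.log y ≤ 2 / 3 * y + 1 - 2 / y + 1 / (3 * y ^ 2) := by
  let h : ℝ → ℝ := fun y => 2 / 3 * y + 1 - 2 * y⁻¹ + 1 / 3 * (y⁻¹) ^ 2 - 2 * Real.log y
  have hd : ∀ y : ℝ, 0 < y → HasDerivAt h (2 / 3 * (y - 1) ^ 3 / y ^ 3) y := by
    intro y hy
    have h1 := hasDerivAt_inv hy.ne'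
    have h2 := ((((hasDerivAt_id y).const_mul (2 / 3 : ℝ)).add_const (1 : ℝ)).sub
      (h1.const_mul 2)).add ((h1.pow 2).const_mul (1 / 3 : ℝ))
    have h3 := h2.sub ((Real.hasDerivAt_log hy.ne').const_mul 2)
    refine h3.congr_deriv ?_
    rw [show 2 - 1 = 1 from rfl, pow_one, Nat.cast_ofNat]
    field_simp
    ring
  have key : h 1 ≤ h y := by
    rcases le_total 1 y with h1 | h1
    · refine (monotoneOn_of_deriv_nonneg (convex_Ici (1 : ℝ)) ?_ ?_ ?_) Set.self_mem_Ici h1 h1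
      · exact fun x hx => (hd x (by linarith [Set.mem_Ici.1 hx])).continuousAt.continuousWithinAt
      · intro x hx
        rw [interior_Ici] at hx
        exact (hd x (by linarith [Set.mem_Ioi.1 hx])).differentiableAt.differentiableWithinAt
      · intro x hx
        rw [interior_Ici, Set.mem_Ioi] at hx
        have : 0 ≤ x - 1 := by linarith
        rw [(hd x (by linarith)).deriv]
        have : 0 < x := by linarith
        positivity
    · refine (antitoneOn_of_deriv_nonpos (convex_Icc y 1) ?_ ?_ ?_)
        (Set.left_mem_Icc.2 h1) (Set.right_mem_Icc.2 h1) h1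
      · exact fun x hx => (hd x (by linarith [hx.1])).continuousAt.continuousWithinAt
      · intro x hx
        rw [interior_Icc] at hx
        exact (hd x (by linarith [hx.1])).differentiableAt.differentiableWithinAt
      · intro x hx
        rw [interior_Icc] at hx
        have h0 : 0 < x := by linarith [hx.1]
        rw [(hd x h0).deriv]
        have h2 : (x - 1) ^ 3 ≤ 0 := Odd.pow_nonpos (by decide) (by linarith [hx.2])
        exact div_nonpos_of_nonpos_of_nonneg (by linarith) (by positivity)
  have e1 : h 1 = 0 := by simp only [h]; norm_num
  have e2 : h y = 2 / 3 * y + 1 - 2 / y + 1 / (3 * y ^ 2) - 2 * Real.log y := by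
    simp only [h]; field_simp
  linarith

theorem sq_mul_log_sq_le {y : ℝ} (hy : 0 ≤ y) :
    y ^ 2 * Real.log (y ^ 2) ≤ 2 / 3 * y ^ 3 + y ^ 2 - 2 * y + 1 / 3 := by
  rcases hy.eq_or_lt with rfl | hy
  · norm_num
  · rw [Real.log_pow]
    have := mul_le_mul_of_nonneg_left (two_mul_log_le hy) (sq_nonneg y)
    have e : y ^ 2 * (2 / 3 * y + 1 - 2 / y + 1 / (3 * y ^ 2))
        = 2 / 3 * y ^ 3 + y ^ 2 - 2 * y + 1 / 3 := by field_simp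
    push_cast
    linarith

/-- The bound on the logarithm at 1/y, reversed by log(1/y) = -log y. It serves the optimality of
the constant. -/
theorem le_sq_mul_log_sq {y : ℝ} (hy : 0 < y) :
    -(2 / 3) * y - y ^ 2 + 2 * y ^ 3 - y ^ 4 / 3 ≤ y ^ 2 * Real.log (y ^ 2) := by
  rw [Real.log_pow]
  have h := mul_le_mul_of_nonneg_left (two_mul_log_le (inv_pos.2 hy)) (sq_nonneg y)
  rw [Real.log_inv] at h
  have e : y ^ 2 * (2 / 3 * y⁻¹ + 1 - 2 / y⁻¹ + 1 / (3 * y⁻¹ ^ 2))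
      = 2 / 3 * y + y ^ 2 - 2 * y ^ 3 + y ^ 4 / 3 := by field_simp
  push_cast
  linarith

end LogBounds

/-! ### Combinatorics of zero-sum triples of frequencies. -/

section Weights

variable {n : ℕ}

/-- Two elements of `ZMod n` whose representatives of least absolute value are both strictly
between `0` and `n / 2`, or both strictly between `-n / 2` and `0`. -/
def SameSign (i j : ZMod n) : Prop :=
  (0 < i.val ∧ 2 * i.val < n ∧ 0 < j.val ∧ 2 * j.val < n) ∨ (n < 2 * i.val ∧ n < 2 * j.val)

open Classical in
/-- The share of the triple `(i, j, -(i + j))` attributed to its third entry. -/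
noncomputable def share (i j : ZMod n) : ℝ :=
  if SameSign i j then
    if SameSign i (-(i + j)) then ((psi n (i + j) : ℝ) - 1) / ((n : ℝ) - 3) else 1
  else 0

theorem SameSign.symm {i j : ZMod n} (h : SameSign i j) : SameSign j i := by
  unfold SameSign at *; omega

theorem SameSign.trans {i j k : ZMod n} (h : SameSign i j) (h' : SameSign j k) :
    SameSign i k := by
  unfold SameSign at *; omega

theorem val_pos_of_ne_zero {i : ZMod n} (hi : i ≠ 0) : 0 < i.val :=
  Nat.pos_of_ne_zero ((ZMod.val_ne_zero i).2 hi)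

variable [NeZero n]

theorem val_add_eq_or (i j : ZMod n) :
    (i + j).val = i.val + j.val ∧ i.val + j.val < n ∨ (i + j).val + n = i.val + j.val := by
  rcases lt_or_ge (i.val + j.val) n with h | h
  · exact Or.inl ⟨ZMod.val_add_of_lt h, h⟩
  · exact Or.inr (ZMod.val_add_val_of_le h).symm

theorem val_neg_add {i : ZMod n} (hi : i ≠ 0) : (-i).val + i.val = n := by
  have : NeZero i := ⟨hi⟩
  rw [ZMod.val_neg_of_ne_zero]
  have := i.val_lt
  omega

theorem psi_neg (i : ZMod n) : psi n (-i) = psi n i := by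
  by_cases hi : i = 0
  · simp [hi]
  · have := val_neg_add hi
    unfold psi
    omega

open Classical in
theorem share_eq_of_add_eq_zero {i j k : ZMod n} (h : i + j + k = 0) :
    share i j = if SameSign i j then
      if SameSign i k then ((psi n k : ℝ) - 1) / ((n : ℝ) - 3) else 1 else 0 := by
  obtain rfl : k = -(i + j) := (neg_eq_of_add_eq_zero_right h).symm
  rw [share, psi_neg]

theorem val_add_val_add_val {i j k : ZMod n} (hk : k ≠ 0) (h : i + j + k = 0) :
    i.val + j.val + k.val = n ∨ i.val + j.val + k.val = 2 * n := by
  obtain rfl : k = -(i + j) := (neg_eq_of_add_eq_zero_right h).symm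
  have h4 := val_neg_add (neg_ne_zero.1 hk)
  have h5 := val_add_eq_or i j
  omega

/-- If no entry is n/2, this is the pigeonhole principle for two signs. Two entries n/2 would make
the third zero; if one is n/2, the condition on the sum puts the other two on the same side. -/
theorem sameSign_or {i j k : ZMod n} (hi : i ≠ 0) (hj : j ≠ 0) (hk : k ≠ 0)
    (h : i + j + k = 0) : SameSign i j ∨ SameSign j k ∨ SameSign k i := by
  have h1 := val_pos_of_ne_zero hi
  have h2 := val_pos_of_ne_zero hj
  have h3 := val_pos_of_ne_zero hk
  have b1 := i.val_lt
  have b2 := j.val_lt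
  have b3 := k.val_lt
  have h4 := val_add_val_add_val hk h
  unfold SameSign
  rcases lt_trichotomy (2 * i.val) n with a | a | a <;>
  rcases lt_trichotomy (2 * j.val) n with b | b | b <;>
  rcases lt_trichotomy (2 * k.val) n with c | c | c <;> omega

/-- A single same-sign pair carries the whole weight 1. If all three signs agree, the three values
of ψ add up to n, so the numerators ψ - 1 add up to the denominator n - 3. -/
theorem share_add_share_add_share (hn : 4 ≤ n) {i j : ZMod n} (hi : i ≠ 0) (hj : j ≠ 0)
    (hij : i + j ≠ 0) : share i j + share j (-(i + j)) + share (-(i + j)) i = 1 := by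
  have hn' : (n : ℝ) - 3 ≠ 0 := by
    have : (4 : ℝ) ≤ n := by exact_mod_cast hn
    linarith
  obtain ⟨k, hk⟩ : ∃ k, k = -(i + j) := ⟨_, rfl⟩
  have hk0 : k ≠ 0 := hk ▸ neg_ne_zero.2 hij
  have hsum : i + j + k = 0 := by rw [hk, add_neg_cancel]
  rw [← hk, share_eq_of_add_eq_zero hsum,
    share_eq_of_add_eq_zero (show j + k + i = 0 by rw [← hsum]; ring),
    share_eq_of_add_eq_zero (show k + i + j = 0 by rw [← hsum]; ring)]
  by_cases x : SameSign i j
  · by_cases y : SameSign j k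
    · have hs : psi n k + psi n i + psi n j = n := by
        have h4 := val_add_val_add_val hk0 hsum
        unfold SameSign psi at *
        omega
      have hs' : (psi n k : ℝ) + psi n i + psi n j = n := by exact_mod_cast hs
      have z := (x.trans y).symm
      rw [if_pos x, if_pos y, if_pos z, if_pos z.symm, if_pos x.symm, if_pos y.symm]
      field_simp
      linarith
    · have z : ¬ SameSign i k := fun z => y (x.symm.trans z)
      have z' : ¬ SameSign k i := fun h => z h.symm
      simp [x, y, z, z']
  · by_cases y : SameSign j k
    · have z : ¬ SameSign k i := fun z => x (y.trans z).symm
      have x' : ¬ SameSign j i := fun h => x h.symm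
      simp [x, y, z, x']
    · have z := ((sameSign_or hi hj hk0 hsum).resolve_left x).resolve_left y
      have y' : ¬ SameSign k j := fun h => y h.symm
      simp [x, y, z, y']

open Classical in
theorem sum_share_sq_le (hn : 4 ≤ n) {k : ZMod n} (hk : k ≠ 0) :
    ∑ i : ZMod n, share i (k - i) ^ 2 ≤ 2 * ((psi n k : ℝ) - 1) := by
  set w : ℝ := ((psi n k : ℝ) - 1) / ((n : ℝ) - 3) with hw
  have hk0 := val_pos_of_ne_zero hk
  have hkn := k.val_lt
  have hneg := val_neg_add hk
  set S := Finset.univ.filter fun i : ZMod n => SameSign i (k - i) ∧ ¬ SameSign i (-k) with hS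
  set W := Finset.univ.filter fun i : ZMod n => SameSign i (k - i) ∧ SameSign i (-k) with hW
  have hsum : ∑ i : ZMod n, share i (k - i) ^ 2 = S.card + W.card * w ^ 2 := by
    have : ∀ i : ZMod n, share i (k - i) ^ 2
        = (if SameSign i (k - i) ∧ ¬ SameSign i (-k) then 1 else 0)
          + (if SameSign i (k - i) ∧ SameSign i (-k) then w ^ 2 else 0) := by
      intro i
      have e : i + (k - i) = k := by ring
      simp only [share, e]
      by_cases h1 : SameSign i (k - i) <;> by_cases h2 : SameSign i (-k) <;> simp [h1, h2, hw]
    simp only [this, Finset.sum_add_distrib, ← Finset.sum_filter]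
    simp [hS, hW]
  have hadd : ∀ i : ZMod n, k.val = i.val + (k - i).val ∧ i.val + (k - i).val < n ∨
      k.val + n = i.val + (k - i).val := by
    intro i
    have := val_add_eq_or i (k - i)
    rwa [show i + (k - i) = k by ring] at this
  have card_le : ∀ (s : Finset (ZMod n)) (t : Finset ℕ), (∀ i ∈ s, i.val ∈ t) →
      s.card ≤ t.card := fun s t h =>
    Finset.card_le_card_of_injOn _ h (ZMod.val_injective n).injOn
  -- For k = n/2 the element -k has no sign, so W is empty and pairs of both signs lie in S.
  -- Otherwise S consists of pairs with the sign of k, and W of pairs with the sign of -k.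
  have bounds : S.card ≤ 2 * (psi n k - 1) ∧ W.card = 0 ∨
      S.card ≤ psi n k - 1 ∧ W.card ≤ psi n k ∧ 2 * psi n k < n := by
    rcases lt_trichotomy (2 * k.val) n with h | h | h
    · right
      refine ⟨(card_le S (Finset.Ioo 0 k.val) ?_).trans ?_,
        (card_le W (Finset.Ioc (n / 2) (n / 2 + k.val)) ?_).trans ?_, ?_⟩
      · intro i hi
        have hi := (Finset.mem_filter.1 hi).2
        have := hadd i
        have := i.val_lt
        unfold SameSign at hi
        rw [Finset.mem_Ioo]; omega
      · rw [Nat.card_Ioo]; unfold psi; omega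
      · intro i hi
        have hi := (Finset.mem_filter.1 hi).2
        have := hadd i
        have := i.val_lt
        unfold SameSign at hi
        rw [Finset.mem_Ioc]; omega
      · rw [Nat.card_Ioc]; unfold psi; omega
      · unfold psi; omega
    · left
      refine ⟨(card_le S (Finset.Ioo 0 k.val ∪ Finset.Ioo k.val n) ?_).trans
        ((Finset.card_union_le _ _).trans ?_), ?_⟩
      · intro i hi
        have hi := (Finset.mem_filter.1 hi).2
        have := i.val_lt
        unfold SameSign at hi
        rw [Finset.mem_union, Finset.mem_Ioo, Finset.mem_Ioo]; omega
      · rw [Nat.card_Ioo, Nat.card_Ioo]; unfold psi; omega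
      · rw [Finset.card_eq_zero, hW, Finset.filter_eq_empty_iff]
        intro i _ hi
        unfold SameSign at hi
        omega
    · right
      refine ⟨(card_le S (Finset.Ioo k.val n) ?_).trans ?_,
        (card_le W (Finset.Ico (k.val - n / 2) ((n + 1) / 2)) ?_).trans ?_, ?_⟩
      · intro i hi
        have hi := (Finset.mem_filter.1 hi).2
        have := hadd i
        have := i.val_lt
        have := (k - i).val_lt
        unfold SameSign at hi
        rw [Finset.mem_Ioo]; omega
      · rw [Nat.card_Ioo]; unfold psi; omega
      · intro i hi
        have hi := (Finset.mem_filter.1 hi).2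
        have := hadd i
        have := i.val_lt
        have := (k - i).val_lt
        unfold SameSign at hi
        rw [Finset.mem_Ico]; omega
      · rw [Nat.card_Ico]; unfold psi; omega
      · unfold psi; omega
  have hpsi : 1 ≤ psi n k := by unfold psi; omega
  have hpsi' : (1 : ℝ) ≤ psi n k := by exact_mod_cast hpsi
  have hn4 : (4 : ℝ) ≤ n := by exact_mod_cast hn
  rw [hsum]
  rcases bounds with ⟨h1, h2⟩ | ⟨h1, h2, h3⟩
  · have h1' : (S.card : ℝ) ≤ 2 * ((psi n k : ℝ) - 1) := by
      have := (Nat.cast_le (α := ℝ)).2 h1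
      rwa [Nat.cast_mul, Nat.cast_sub hpsi, Nat.cast_ofNat, Nat.cast_one] at this
    simp only [h2, Nat.cast_zero, zero_mul, add_zero]
    exact h1'
  · have h1' : (S.card : ℝ) ≤ (psi n k : ℝ) - 1 := by
      have := (Nat.cast_le (α := ℝ)).2 h1
      rwa [Nat.cast_sub hpsi, Nat.cast_one] at this
    have h2' : (W.card : ℝ) ≤ psi n k := by exact_mod_cast h2
    have h3' : 2 * (psi n k : ℝ) + 1 ≤ n := by exact_mod_cast h3
    have hw1 : W.card * w ^ 2 ≤ psi n k * w ^ 2 :=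
      mul_le_mul_of_nonneg_right h2' (sq_nonneg w)
    have hw2 : psi n k * w ^ 2 ≤ (psi n k : ℝ) - 1 := by
      have hpos : 0 < (n : ℝ) - 3 := by linarith
      rw [hw, div_pow, mul_div_assoc', div_le_iff₀ (by positivity)]
      -- Here n - 3 is at least both 1 and 2(ψ(k) - 1).
      have : (psi n k : ℝ) * (psi n k - 1) ≤ ((n : ℝ) - 3) ^ 2 := by nlinarith
      nlinarith
    linarith

open Classical in
-- Replacing j by -j preserves the weights, and i cannot share its sign with both j and -j, so
-- same-sign pairs carry at most half of the total.
theorem sum_sameSign_le {B : ZMod n → ℝ} (hB : ∀ k, 0 ≤ B k) (hs : ∀ k, B (-k) = B k) :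
    ∑ i : ZMod n, ∑ j : ZMod n, (if SameSign i j then B i * B j else 0)
      ≤ 1 / 2 * (∑ k, B k) ^ 2 := by
  have h1 : ∑ i : ZMod n, ∑ j : ZMod n, (if SameSign i j then B i * B j else 0)
      = ∑ i : ZMod n, ∑ j : ZMod n, (if SameSign i (-j) then B i * B j else 0) := by
    refine Finset.sum_congr rfl fun i _ => ?_
    refine Fintype.sum_equiv (Equiv.neg _) _ _ fun j => ?_
    simp [hs]
  have h2 : ∑ i : ZMod n, ∑ j : ZMod n, (if SameSign i j then B i * B j else 0)
      + ∑ i : ZMod n, ∑ j : ZMod n, (if SameSign i (-j) then B i * B j else 0)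
      ≤ (∑ k, B k) ^ 2 := by
    rw [sq, Finset.sum_mul_sum, ← Finset.sum_add_distrib]
    refine Finset.sum_le_sum fun i _ => ?_
    rw [← Finset.sum_add_distrib]
    refine Finset.sum_le_sum fun j _ => ?_
    have hnn := mul_nonneg (hB i) (hB j)
    have hnot : ¬ (SameSign i j ∧ SameSign i (-j)) := by
      rintro ⟨a, b⟩
      by_cases hj : j = 0
      · subst hj
        simp [SameSign] at a
      · have := val_neg_add hj
        unfold SameSign at a b
        omega
    by_cases a : SameSign i j <;> by_cases b : SameSign i (-j)
    · exact absurd ⟨a, b⟩ hnot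
    all_goals simp [a, b, hnn]
  linarith

theorem sum_mul_mul_add_le (hn : 4 ≤ n) {A : ZMod n → ℝ} (hA0 : A 0 = 0)
    (hs : ∀ k, A (-k) = A k) :
    ∑ i : ZMod n, ∑ j : ZMod n, A i * A j * A (i + j)
      ≤ 3 * ∑ k : ZMod n, ((psi n k : ℝ) - 1) * A k ^ 2 + 3 / 4 * (∑ k, A k ^ 2) ^ 2 := by
  classical
  -- Cyclic rotation of the triple (i, j, -(i + j)); it makes the three shares contribute equally.
  have rot : ∀ F : ZMod n → ZMod n → ℝ,
      ∑ i : ZMod n, ∑ j : ZMod n, F i j = ∑ i : ZMod n, ∑ j : ZMod n, F j (-(i + j)) := by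
    intro F
    rw [Finset.sum_comm]
    nth_rewrite 2 [Finset.sum_comm]
    rw [Finset.sum_comm]
    refine Finset.sum_congr rfl fun j _ => ?_
    refine Fintype.sum_equiv ((Equiv.addRight j).trans (Equiv.neg _)) _ _ fun i => ?_
    simp
  have inv : ∀ i j, A j * A (-(i + j)) * A (j + -(i + j)) = A i * A j * A (i + j) := by
    intro i j
    rw [show j + -(i + j) = -i by ring, hs, hs]
    ring
  have split : ∑ i : ZMod n, ∑ j : ZMod n, A i * A j * A (i + j)
      = 3 * ∑ i : ZMod n, ∑ j : ZMod n, share i j * (A i * A j * A (i + j)) := by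
    have r1 := rot fun i j => share i j * (A i * A j * A (i + j))
    have r2 := rot fun i j => share j (-(i + j)) * (A j * A (-(i + j)) * A (j + -(i + j)))
    have e : ∀ i j : ZMod n, -(j + -(i + j)) = i := fun i j => by ring
    simp only [e] at r2
    have : ∑ i : ZMod n, ∑ j : ZMod n, A i * A j * A (i + j)
        = ∑ i : ZMod n, ∑ j : ZMod n, (share i j * (A i * A j * A (i + j))
          + share j (-(i + j)) * (A j * A (-(i + j)) * A (j + -(i + j)))
          + share (-(i + j)) i * (A (-(i + j)) * A i * A (-(i + j) + i))) := by
      refine Finset.sum_congr rfl fun i _ => Finset.sum_congr rfl fun j _ => ?_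
      have e3 : A (-(i + j)) * A i * A (-(i + j) + i) = A i * A j * A (i + j) := by
        rw [show -(i + j) + i = -j by ring, hs, hs]
        ring
      rw [inv, e3, ← add_mul, ← add_mul]
      by_cases hi : i = 0
      · simp [hi, hA0]
      by_cases hj : j = 0
      · simp [hj, hA0]
      by_cases hij : i + j = 0
      · simp [hij, hA0]
      rw [share_add_share_add_share hn hi hj hij, one_mul]
    simp only [Finset.sum_add_distrib] at this
    linarith
  have amgm : ∑ i : ZMod n, ∑ j : ZMod n, share i j * (A i * A j * A (i + j))
      ≤ 1 / 2 * (∑ i : ZMod n, ∑ j : ZMod n, share i j ^ 2 * A (i + j) ^ 2)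
        + 1 / 2 * ∑ i : ZMod n, ∑ j : ZMod n,
          (if SameSign i j then A i ^ 2 * A j ^ 2 else 0) := by
    simp only [Finset.mul_sum, ← Finset.sum_add_distrib]
    refine Finset.sum_le_sum fun i _ => Finset.sum_le_sum fun j _ => ?_
    by_cases h : SameSign i j
    · rw [if_pos h]
      nlinarith [sq_nonneg (share i j * A (i + j) - A i * A j)]
    · simp [share, h]
  have first : ∑ i : ZMod n, ∑ j : ZMod n, share i j ^ 2 * A (i + j) ^ 2
      ≤ 2 * ∑ k : ZMod n, ((psi n k : ℝ) - 1) * A k ^ 2 := by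
    have : ∑ i : ZMod n, ∑ j : ZMod n, share i j ^ 2 * A (i + j) ^ 2
        = ∑ k : ZMod n, (∑ i : ZMod n, share i (k - i) ^ 2) * A k ^ 2 := by
      simp only [Finset.sum_mul]
      rw [Finset.sum_comm (s := Finset.univ) (t := Finset.univ)
        (f := fun k i => share i (k - i) ^ 2 * A k ^ 2)]
      refine Finset.sum_congr rfl fun i _ => ?_
      refine Fintype.sum_equiv (Equiv.addLeft i) _ _ fun j => ?_
      simp
    rw [this, Finset.mul_sum]
    refine Finset.sum_le_sum fun k _ => ?_
    by_cases hk : k = 0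
    · simp [hk, hA0]
    · rw [← mul_assoc]
      exact mul_le_mul_of_nonneg_right (sum_share_sq_le hn hk) (sq_nonneg _)
  have second := sum_sameSign_le (B := fun k => A k ^ 2) (fun k => sq_nonneg _)
    (fun k => by simp only [hs])
  linarith

end Weights

/-! ### Fourier expansions of the norm, the cubic integral and the energy. -/

section Fourier

variable {n : ℕ} [NeZero n]

theorem sum_chi (k : ZMod n) : ∑ x : ZMod n, chi n k x = if k = 0 then (n : ℂ) else 0 := by
  simp only [chi_eq_stdAddChar]
  have := AddChar.sum_mulShift k (ZMod.isPrimitive_stdAddChar n)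
  simp only [mul_comm _ k, ZMod.card] at this
  rw [this]
  split_ifs <;> simp

theorem chi_mul_chi (i j x : ZMod n) : chi n i x * chi n j x = chi n (i + j) x := by
  simp only [chi_eq_stdAddChar, add_mul, AddChar.map_add_eq_mul]

theorem conj_chi_eq (k x : ZMod n) : (starRingEnd ℂ) (chi n k x) = chi n (-k) x := by
  rw [conj_chi, chi_eq_stdAddChar]
  congr 1
  ring

theorem chi_zero (x : ZMod n) : chi n 0 x = 1 := by simp [chi_eq_stdAddChar]

theorem coeff_neg (f : ZMod n → ℝ) (k : ZMod n) :
    coeff n (fun x => (f x : ℂ)) (-k) = (starRingEnd ℂ) (coeff n (fun x => (f x : ℂ)) k) := by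
  simp [coeff, map_sum, conj_chi_eq]

theorem sum_sq_eq (f : ZMod n → ℂ) :
    (n : ℝ)⁻¹ * ∑ x, ‖f x‖ ^ 2 = ∑ k, ‖coeff n f k‖ ^ 2 := by
  have h : (n : ℂ)⁻¹ * ∑ x, (starRingEnd ℂ) (f x) * f x
      = ∑ k, (starRingEnd ℂ) (coeff n f k) * coeff n f k := by
    have : ∀ k, (starRingEnd ℂ) (coeff n f k)
        = (n : ℂ)⁻¹ * ∑ x : ZMod n, chi n k x * (starRingEnd ℂ) (f x) := by
      intro k; simp [coeff, map_sum]
    simp only [this, Finset.mul_sum, Finset.sum_mul]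
    rw [Finset.sum_comm]
    refine Finset.sum_congr rfl fun x _ => ?_
    conv_lhs => rw [← sum_coeff_mul_chi n f x]
    rw [sum_coeff_mul_chi, ← sum_coeff_mul_chi n f x, Finset.mul_sum, Finset.mul_sum]
    refine Finset.sum_congr rfl fun k _ => ?_
    rw [sum_coeff_mul_chi]
    ring
  simp only [Complex.conj_mul'] at h
  apply Complex.ofReal_injective
  push_cast
  exact h

theorem sum_cube_eq (f : ZMod n → ℂ) :
    (n : ℂ)⁻¹ * ∑ x, f x ^ 3
      = ∑ i, ∑ j, coeff n f i * coeff n f j * coeff n f (-(i + j)) := by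
  have hx : ∀ x, f x ^ 3 = ∑ i, ∑ j, ∑ k,
      coeff n f i * coeff n f j * coeff n f k * chi n (i + j + k) x := by
    intro x
    rw [pow_succ, sq, ← sum_coeff_mul_chi n f x, Finset.sum_mul_sum, Finset.sum_mul]
    refine Finset.sum_congr rfl fun i _ => ?_
    rw [Finset.sum_mul]
    refine Finset.sum_congr rfl fun j _ => ?_
    rw [Finset.mul_sum]
    refine Finset.sum_congr rfl fun k _ => ?_
    rw [← chi_mul_chi, ← chi_mul_chi]
    ring
  have hn : (n : ℂ) ≠ 0 := NeZero.ne _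
  simp only [hx]
  rw [Finset.sum_comm, Finset.mul_sum]
  refine Finset.sum_congr rfl fun i _ => ?_
  rw [Finset.sum_comm, Finset.mul_sum]
  refine Finset.sum_congr rfl fun j _ => ?_
  rw [Finset.sum_comm]
  simp only [← Finset.mul_sum, sum_chi]
  rw [Finset.sum_eq_single (-(i + j))]
  · rw [if_pos (by ring)]
    field_simp
  · intro k _ hk
    rw [if_neg (fun h => hk (eq_neg_of_add_eq_zero_right h)), mul_zero]
  · simp

theorem energy_eq (f : ZMod n → ℝ) :
    energy n f = ∑ k, (psi n k : ℝ) * ‖coeff n (fun x => (f x : ℂ)) k‖ ^ 2 := by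
  rw [energy, l2Inner_generator, Complex.ofReal_re]

theorem entropy_eq (f : ZMod n → ℝ) :
    entropy n f = (n : ℝ)⁻¹ * ∑ x, f x ^ 2 * Real.log (f x ^ 2)
      - ((n : ℝ)⁻¹ * ∑ x, f x ^ 2) * Real.log ((n : ℝ)⁻¹ * ∑ x, f x ^ 2) := by
  rw [entropy, lpNorm_two_sq, integral_mu, smul_eq_mul]

theorem coeff_const_mul (c : ℂ) (f : ZMod n → ℂ) (k : ZMod n) :
    coeff n (fun x => c * f x) k = c * coeff n f k := by
  simp only [coeff, Finset.mul_sum]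
  exact Finset.sum_congr rfl fun x _ => by ring

theorem coeff_add (f g : ZMod n → ℂ) (k : ZMod n) :
    coeff n (fun x => f x + g x) k = coeff n f k + coeff n g k := by
  simp only [coeff, mul_add, Finset.sum_add_distrib]

theorem coeff_chi (i k : ZMod n) : coeff n (chi n i) k = if i = k then 1 else 0 := by
  have hn : (n : ℂ) ≠ 0 := NeZero.ne _
  simp only [coeff, conj_chi_eq, chi_mul_chi, sum_chi]
  by_cases h : i = k
  · simp [h, hn]
  · have : -k + i ≠ 0 := fun h' => h (neg_add_eq_zero.1 h').symm
    simp [h, this]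

theorem coeff_const (c : ℂ) (k : ZMod n) :
    coeff n (fun _ => c) k = if 0 = k then c else 0 := by
  have := coeff_const_mul c (chi n 0) k
  simp only [chi_zero, mul_one, coeff_chi] at this
  rw [this]
  split_ifs <;> simp

end Fourier

/-! ### The log-Sobolev inequality. -/

section Inequality

variable {n : ℕ} [NeZero n]

theorem sum_cube_le (hn : 4 ≤ n) {g : ZMod n → ℝ} (hg : ∑ x, g x = 0) :
    (n : ℝ)⁻¹ * ∑ x, g x ^ 3
      ≤ 3 * (energy n g - (n : ℝ)⁻¹ * ∑ x, g x ^ 2) + 3 / 4 * ((n : ℝ)⁻¹ * ∑ x, g x ^ 2) ^ 2 := by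
  set a := coeff n (fun x => (g x : ℂ)) with ha
  have h0 : ‖a 0‖ = 0 := by
    rw [norm_eq_zero, ha, coeff]
    simp only [chi_zero, map_one, one_mul]
    rw [← Complex.ofReal_sum, hg]
    simp
  have hneg : ∀ k, ‖a (-k)‖ = ‖a k‖ := fun k => by rw [ha, coeff_neg, Complex.norm_conj]
  have hsq : (n : ℝ)⁻¹ * ∑ x, g x ^ 2 = ∑ k, ‖a k‖ ^ 2 := by
    rw [← sum_sq_eq]; simp
  have hcube : (n : ℝ)⁻¹ * ∑ x, g x ^ 3 ≤ ∑ i, ∑ j, ‖a i‖ * ‖a j‖ * ‖a (i + j)‖ := by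
    have h := sum_cube_eq fun x => (g x : ℂ)
    have e : ((n : ℂ)⁻¹ * ∑ x, (g x : ℂ) ^ 3) = (((n : ℝ)⁻¹ * ∑ x, g x ^ 3 : ℝ) : ℂ) := by
      push_cast; rfl
    rw [e] at h
    refine (le_abs_self _).trans ?_
    rw [← Real.norm_eq_abs, ← Complex.norm_real, h]
    refine (norm_sum_le _ _).trans (Finset.sum_le_sum fun i _ => ?_)
    refine (norm_sum_le _ _).trans (Finset.sum_le_sum fun j _ => ?_)
    rw [norm_mul, norm_mul, hneg]
  have main := sum_mul_mul_add_le hn (A := fun k => ‖a k‖) h0 hneg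
  simp only [sub_mul, one_mul, Finset.sum_sub_distrib] at main
  rw [hsq, energy_eq]
  linarith

theorem energy_add_const (f : ZMod n → ℝ) (c : ℝ) :
    energy n (fun x => f x + c) = energy n f := by
  rw [energy_eq, energy_eq]
  refine Finset.sum_congr rfl fun k _ => ?_
  push_cast
  rw [coeff_add (fun x => (f x : ℂ)) fun _ => (c : ℂ), coeff_const]
  by_cases hk : 0 = k
  · subst hk; simp [psi]
  · simp [hk]

theorem energy_const_mul (c : ℝ) (f : ZMod n → ℝ) :
    energy n (fun x => c * f x) = c ^ 2 * energy n f := by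
  rw [energy_eq, energy_eq, Finset.mul_sum]
  refine Finset.sum_congr rfl fun k _ => ?_
  push_cast
  rw [coeff_const_mul, norm_mul, Complex.norm_real, mul_pow, Real.norm_eq_abs, sq_abs]
  ring

theorem entropy_const_mul {c : ℝ} (hc : 0 < c) {f : ZMod n → ℝ} (hf : 0 < ∑ x, f x ^ 2) :
    entropy n (fun x => c * f x) = c ^ 2 * entropy n f := by
  have hn : (0 : ℝ) < n := Nat.cast_pos.2 (NeZero.pos n)
  have h1 : ∀ x, (c * f x) ^ 2 * Real.log ((c * f x) ^ 2)
      = c ^ 2 * (f x ^ 2 * Real.log (f x ^ 2)) + c ^ 2 * Real.log (c ^ 2) * f x ^ 2 := by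
    intro x
    by_cases hx : f x = 0
    · simp [hx]
    · rw [mul_pow, Real.log_mul (by positivity) (by positivity)]
      ring
  have h2 : (n : ℝ)⁻¹ * ∑ x, (c * f x) ^ 2 = c ^ 2 * ((n : ℝ)⁻¹ * ∑ x, f x ^ 2) := by
    simp only [mul_pow, ← Finset.mul_sum]; ring
  rw [entropy_eq, entropy_eq, h2, Real.log_mul (by positivity) (by positivity)]
  simp only [h1, Finset.sum_add_distrib, ← Finset.mul_sum]
  ring

theorem entropy_le_of_norm_eq_one (hn : 4 ≤ n) {f : ZMod n → ℝ} (hf : ∀ x, 0 ≤ f x)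
    (h1 : (n : ℝ)⁻¹ * ∑ x, f x ^ 2 = 1) : entropy n f ≤ 2 * energy n f := by
  have hn0 : (0 : ℝ) < n := Nat.cast_pos.2 (NeZero.pos n)
  have hnn : (n : ℝ)⁻¹ * n = 1 := inv_mul_cancel₀ hn0.ne'
  set m : ℝ := (n : ℝ)⁻¹ * ∑ x, f x with hm
  have hm0 : 0 ≤ m := mul_nonneg (by positivity) (Finset.sum_nonneg fun x _ => hf x)
  set g : ZMod n → ℝ := fun x => f x + -m with hg
  have hconst : ∀ c : ℝ, ∑ _x : ZMod n, c = n * c := fun c => by simp [ZMod.card]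
  have hg0 : ∑ x, g x = 0 := by
    simp only [hg, Finset.sum_add_distrib, hconst, hm]
    field_simp
    ring
  have hg2 : (n : ℝ)⁻¹ * ∑ x, g x ^ 2 = 1 - m ^ 2 := by
    have : ∀ x, g x ^ 2 = f x ^ 2 - 2 * m * f x + m ^ 2 := fun x => by simp only [hg]; ring
    simp only [this, Finset.sum_add_distrib, Finset.sum_sub_distrib, hconst, ← Finset.mul_sum]
    linear_combination h1 + 2 * m * hm + m ^ 2 * hnn
  have hg3 : (n : ℝ)⁻¹ * ∑ x, f x ^ 3
      = (n : ℝ)⁻¹ * ∑ x, g x ^ 3 + 3 * m * (1 - m ^ 2) + m ^ 3 := by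
    have : ∀ x, f x ^ 3 = g x ^ 3 + 3 * m * g x ^ 2 + 3 * m ^ 2 * g x + m ^ 3 :=
      fun x => by simp only [hg]; ring
    simp only [this, Finset.sum_add_distrib, hconst, ← Finset.mul_sum, hg0]
    linear_combination 3 * m * hg2 + m ^ 3 * hnn
  have hm1 : m ≤ 1 := by
    have : 0 ≤ 1 - m ^ 2 := hg2 ▸ by positivity
    nlinarith
  have hE : energy n g = energy n f := energy_add_const f (-m)
  have hc := sum_cube_le hn hg0
  rw [hg2, hE] at hc
  have hlog : (n : ℝ)⁻¹ * ∑ x, f x ^ 2 * Real.log (f x ^ 2)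
      ≤ 2 / 3 * ((n : ℝ)⁻¹ * ∑ x, f x ^ 3) + 1 - 2 * m + 1 / 3 := by
    have h : (n : ℝ)⁻¹ * ∑ x, f x ^ 2 * Real.log (f x ^ 2)
        ≤ (n : ℝ)⁻¹ * ∑ x, (2 / 3 * f x ^ 3 + f x ^ 2 - 2 * f x + 1 / 3) :=
      mul_le_mul_of_nonneg_left (Finset.sum_le_sum fun x _ => sq_mul_log_sq_le (hf x))
        (by positivity)
    refine h.trans_eq ?_
    simp only [Finset.sum_add_distrib, Finset.sum_sub_distrib, hconst, ← Finset.mul_sum]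
    linear_combination h1 + 2 * hm + 1 / 3 * hnn
  -- Six times the slack left after combining `hlog`, `hg3` and `hc`.
  have hpoly : 0 ≤ (1 - m) ^ 3 * (3 * m + 1) :=
    mul_nonneg (pow_nonneg (by linarith) 3) (by linarith)
  rw [entropy_eq, h1, Real.log_one]
  nlinarith

theorem entropy_le (hn : 4 ≤ n) {f : ZMod n → ℝ} (hf : ∀ x, 0 ≤ f x) :
    entropy n f ≤ 2 * energy n f := by
  have hn0 : (0 : ℝ) < n := Nat.cast_pos.2 (NeZero.pos n)
  rcases (Finset.sum_nonneg fun x (_ : x ∈ Finset.univ) => sq_nonneg (f x)).eq_or_lt with h | h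
  · have hz : ∀ x, f x = 0 := fun x =>
      pow_eq_zero_iff two_ne_zero |>.1
        ((Finset.sum_eq_zero_iff_of_nonneg fun x _ => sq_nonneg (f x)).1 h.symm x
          (Finset.mem_univ x))
    have : 0 ≤ energy n f := by
      rw [energy_eq]
      exact Finset.sum_nonneg fun k _ => by positivity
    rw [entropy_eq]
    simp only [hz]
    simpa using this
  · set N := (n : ℝ)⁻¹ * ∑ x, f x ^ 2 with hN
    have hNpos : 0 < N := by positivity
    set c := (Real.sqrt N)⁻¹ with hc
    have hcpos : 0 < c := by positivity
    have hc2 : c ^ 2 * N = 1 := by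
      rw [hc, inv_pow, Real.sq_sqrt hNpos.le, inv_mul_cancel₀ hNpos.ne']
    have key := entropy_le_of_norm_eq_one hn (f := fun x => c * f x)
      (fun x => mul_nonneg hcpos.le (hf x)) (by
        simp only [mul_pow, ← Finset.mul_sum]
        rw [← hc2, hN]; ring)
    rw [entropy_const_mul hcpos h, energy_const_mul] at key
    have : 0 < c ^ 2 := by positivity
    nlinarith

end Inequality

/-! ### Optimality of the constant 2. -/

section Optimality

variable {n : ℕ} [NeZero n]

theorem le_entropy_one_add {h : ZMod n → ℝ} {δ : ℝ} (hδ : δ < 1) (hh : ∀ x, |h x| ≤ δ)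
    (h0 : ∑ x, h x = 0) :
    ((n : ℝ)⁻¹ * ∑ x, h x ^ 2) * (2 - δ - (n : ℝ)⁻¹ * ∑ x, h x ^ 2)
      ≤ entropy n fun x => 1 + h x := by
  have hn0 : (0 : ℝ) < n := Nat.cast_pos.2 (NeZero.pos n)
  have hnn : (n : ℝ)⁻¹ * n = 1 := inv_mul_cancel₀ hn0.ne'
  set s := (n : ℝ)⁻¹ * ∑ x, h x ^ 2 with hs
  have hs0 : 0 ≤ s := by positivity
  have hconst : ∀ c : ℝ, ∑ _x : ZMod n, c = n * c := fun c => by simp [ZMod.card]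
  have hsq : (n : ℝ)⁻¹ * ∑ x, (1 + h x) ^ 2 = 1 + s := by
    have : ∀ x, (1 + h x) ^ 2 = h x ^ 2 + 2 * h x + 1 := fun x => by ring
    simp only [this, Finset.sum_add_distrib, hconst, ← Finset.mul_sum, h0]
    linear_combination hnn - hs
  have hlow : 3 * s - δ * s ≤ (n : ℝ)⁻¹ * ∑ x, (1 + h x) ^ 2 * Real.log ((1 + h x) ^ 2) := by
    have e : 3 * s - δ * s = (n : ℝ)⁻¹ * ∑ x, (2 * h x + (3 - δ) * h x ^ 2) := by
      simp only [Finset.sum_add_distrib, ← Finset.mul_sum, h0]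
      linear_combination (3 - δ) * hs
    rw [e]
    refine mul_le_mul_of_nonneg_left (Finset.sum_le_sum fun x _ => ?_) (by positivity)
    obtain ⟨ha, hb⟩ := abs_le.1 (hh x)
    refine le_trans ?_ (le_sq_mul_log_sq (by linarith : 0 < 1 + h x))
    -- At y = 1 + h the quartic lower bound equals 2h + 3h² + (2/3)h³ - h⁴/3; the last two terms are
    -- at least -δh² as |h| ≤ δ < 1.
    have : 0 ≤ h x ^ 2 * (δ + 2 / 3 * h x - h x ^ 2 / 3) := by
      refine mul_nonneg (sq_nonneg _) ?_
      nlinarith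
    nlinarith
  have hlog : (1 + s) * Real.log (1 + s) ≤ (1 + s) * s :=
    mul_le_mul_of_nonneg_left
      (by linarith [Real.log_le_sub_one_of_pos (by linarith : 0 < 1 + s)]) (by linarith)
  rw [entropy_eq, hsq]
  nlinarith

theorem two_le_of_entropy_le (hn : 4 ≤ n) {C : ℝ}
    (hC : ∀ f : ZMod n → ℝ, (∀ x, 0 ≤ f x) → entropy n f ≤ C * energy n f) : 2 ≤ C := by
  have : Fact (1 < n) := ⟨by omega⟩
  have hv1 : (1 : ZMod n).val = 1 := ZMod.val_one n
  have h1 : (1 : ZMod n) ≠ 0 := one_ne_zero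
  have hv2 := val_neg_add h1
  have hne : (1 : ZMod n) ≠ -1 := fun h => by rw [← h, hv1] at hv2; omega
  have hpsi : psi n 1 = 1 := by unfold psi; omega
  set g : ZMod n → ℝ := fun x => 2 * (chi n 1 x).re with hg
  have hgc : (fun x => (g x : ℂ)) = fun x => chi n 1 x + chi n (-1) x := by
    funext x
    rw [← conj_chi_eq, Complex.add_conj, hg]
  have hcoeff : ∀ k, coeff n (fun x => (g x : ℂ)) k
      = (if 1 = k then 1 else 0) + if -1 = k then 1 else 0 := by
    intro k
    rw [hgc, coeff_add, coeff_chi, coeff_chi]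
  have hnorm : ∀ k, ‖coeff n (fun x => (g x : ℂ)) k‖ ^ 2
      = (if 1 = k then 1 else 0) + if -1 = k then 1 else 0 := by
    intro k
    rw [hcoeff]
    by_cases a : 1 = k
    · subst a; simp [hne.symm]
    · by_cases b : -1 = k <;> simp [a, b]
  have hE : energy n g = 2 := by
    rw [energy_eq]
    simp only [hnorm, mul_add, Finset.sum_add_distrib, mul_ite, mul_one, mul_zero,
      Finset.sum_ite_eq, Finset.mem_univ, if_true, psi_neg, hpsi]
    norm_num
  have hs : (n : ℝ)⁻¹ * ∑ x, g x ^ 2 = 2 := by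
    have := sum_sq_eq fun x => (g x : ℂ)
    simp only [hnorm, Finset.sum_add_distrib, Finset.sum_ite_eq, Finset.mem_univ, if_true,
      Complex.norm_real, Real.norm_eq_abs, sq_abs] at this
    rw [this]; norm_num
  have hg0 : ∑ x, g x = 0 := by
    simp only [hg, ← Finset.mul_sum, ← Complex.re_sum, sum_chi, if_neg h1]
    simp
  have hb : ∀ x, |g x| ≤ 2 := by
    intro x
    have : ‖chi n 1 x‖ = 1 := by rw [chi_eq_stdAddChar]; exact AddChar.norm_apply _ _
    simp only [hg, abs_mul, abs_two]
    linarith [Complex.abs_re_le_norm (chi n 1 x)]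
  by_contra! hlt
  -- The test function gives C ≥ 2 - 2ε - 2ε², which exceeds 2 - 4ε; ε < 1/2 keeps δ = 2ε below 1.
  obtain ⟨ε, hε, hε'⟩ : ∃ ε : ℝ, 0 < ε ∧ ε < 1 / 2 ∧ 4 * ε < 2 - C :=
    ⟨min (1 / 4) ((2 - C) / 8), lt_min (by norm_num) (by linarith),
      (min_le_left _ _).trans_lt (by norm_num), by
        linarith [min_le_right (1 / 4 : ℝ) ((2 - C) / 8)]⟩
  have hle : ∀ x, |ε * g x| ≤ 2 * ε := by
    intro x
    rw [abs_mul, abs_of_pos hε]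
    nlinarith [hb x]
  have low := le_entropy_one_add (by linarith) hle (by rw [← Finset.mul_sum, hg0, mul_zero])
  have hεs : (n : ℝ)⁻¹ * ∑ x, (ε * g x) ^ 2 = 2 * ε ^ 2 := by
    simp only [mul_pow, ← Finset.mul_sum]
    linear_combination ε ^ 2 * hs
  have up := hC (fun x => 1 + ε * g x) fun x => by linarith [(abs_le.1 (hle x)).1]
  have hEε : energy n (fun x => 1 + ε * g x) = 2 * ε ^ 2 := by
    simp only [add_comm (1 : ℝ)]
    rw [energy_add_const (fun x => ε * g x), energy_const_mul, hE]
    ring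
  rw [hεs] at low
  rw [hEε] at up
  have h3 := low.trans up
  have hpos : 0 < 2 * ε ^ 2 := by positivity
  have h4 : 2 - 2 * ε - 2 * ε ^ 2 ≤ C := by
    rw [mul_comm C] at h3
    exact le_of_mul_le_mul_left h3 hpos
  nlinarith

end Optimality

end CyclicLSI

/-- For `n ≥ 4`, the log-Sobolev inequality with constant `2` holds on `ℤ/nℤ` for all nonnegative
functions, and `2` is the least constant for which it does. -/
theorem theorem1p2 (n : ℕ) [NeZero n] (hn : 4 ≤ n) :
    (∀ f : ZMod n → ℝ, (∀ x, 0 ≤ f x) →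
      CyclicLSI.entropy n f ≤ 2 * CyclicLSI.energy n f) ∧
    (∀ C : ℝ, (∀ f : ZMod n → ℝ, (∀ x, 0 ≤ f x) →
      CyclicLSI.entropy n f ≤ C * CyclicLSI.energy n f) → 2 ≤ C) :=
  ⟨fun _ hf => CyclicLSI.entropy_le hn hf, fun _ hC => CyclicLSI.two_le_of_entropy_le hn hC⟩
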